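/- Let $n=14$. A boolean function $f(x_1,\dots,x_n)$ is regarded as a map $f$ from the subsets of $\{1,\dots,n\}$ to $\{0,1\}$, an input being identified with the set of indices $i$ for which $x_i=1$. It is monotone non-increasing if $f(A)=1$ and $B\subseteq A$ imply $f(B)=1$; it is nontrivial if it is not constant; and it is invariant under a group $G$ of permutations of $\{1,\dots,n\}$ if $f(A)=f(\sigma(A))$ for every $\sigma\in G$ and every $A\subseteq\{1,\dots,n\}$. A decision tree of $f$ is a binary tree with inner nodes labelled by variables and leaves labelled by $0$ or $1$, in which every variable appears at most once on each root-leaf path, and such that for every input, starting at the root and moving at each inner node to the left or the right child according as the variable there has value $1$ or $0$, one ends at a leaf labelled by the value of $f$. Let $D(f)$ be the minimum, over all decision trees of $f$, of the depth (the maximum number of inner nodes on a root-leaf path). The function $f$ is elusive if $D(f)=n$. Let $G_1$ be the cyclic group of order $14$ generated by the $14$-cycle $(1,2,\dots,14)$. Then every nontrivial monotone non-increasing $G_1$-invariant boolean function $f(x_1,\dots,x_{14})$ is elusive. -/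

import Mathlib

namespace Elusive

/-- A boolean function of `n` variables. An input is the set of the variables that have value `1`. -/
abbrev BoolFun (n : ℕ) : Type := Finset (Fin n) → Bool

/-- Binary trees whose inner nodes are labelled by variables and whose leaves are labelled by
`0` or `1`. The left child of a node is reached when its variable is `1`, the right child when it
is `0`. -/
inductive DecisionTree (n : ℕ) : Type
  | leaf (b : Bool) : DecisionTree n
  | node (i : Fin n) (left right : DecisionTree n) : DecisionTree n

namespace DecisionTree

variable {n : ℕ}

/-- The label of the leaf that is reached on input `x`. -/
def eval : DecisionTree n → Finset (Fin n) → Bool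
  | leaf b, _ => b
  | node i l r, x => if i ∈ x then l.eval x else r.eval x

/-- The maximum number of inner nodes (equivalently, of edges) on a root-leaf path. -/
def depth : DecisionTree n → ℕ
  | leaf _ => 0
  | node _ l r => max l.depth r.depth + 1

/-- The variables that label some inner node. -/
def vars : DecisionTree n → Finset (Fin n)
  | leaf _ => ∅
  | node i l r => insert i (l.vars ∪ r.vars)

/-- On every root-leaf path each variable appears at most once. -/
def ReadOnce : DecisionTree n → Prop
  | leaf _ => True
  | node i l r => i ∉ l.vars ∧ i ∉ r.vars ∧ l.ReadOnce ∧ r.ReadOnce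

/-- `T` is a decision tree of the boolean function `f`. -/
def IsTreeOf (T : DecisionTree n) (f : BoolFun n) : Prop :=
  T.ReadOnce ∧ ∀ x, T.eval x = f x

end DecisionTree

/-- `D(f)`, the minimum depth among all decision trees of `f`. -/
noncomputable def D {n : ℕ} (f : BoolFun n) : ℕ :=
  sInf {d | ∃ T : DecisionTree n, T.IsTreeOf f ∧ T.depth = d}

/-- `f` is elusive if `D(f)` is the number of its variables. -/
def IsElusive {n : ℕ} (f : BoolFun n) : Prop :=
  D f = n

/-- `f` is nontrivial if it is not constant. -/
def Nontrivial {n : ℕ} (f : BoolFun n) : Prop :=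
  ¬ ∃ b : Bool, ∀ x, f x = b

/-- `f` is monotone non-increasing: subsets of true inputs are true inputs. -/
def MonotoneNonincreasing {n : ℕ} (f : BoolFun n) : Prop :=
  ∀ x y : Finset (Fin n), y ⊆ x → f x = true → f y = true

/-- `f` is `G`-invariant: `f(x) = f(σ(x))` for all `σ ∈ G` and all inputs `x`. -/
def IsInvariant {n : ℕ} (G : Subgroup (Equiv.Perm (Fin n))) (f : BoolFun n) : Prop :=
  ∀ σ ∈ G, ∀ x : Finset (Fin n), f x = f (x.map σ.toEmbedding)

/-- The group generated by the 14-cycle `(1, 2, …, 14)`; the variables are numbered from `0`,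
so the generator is `(0, 1, …, 13)`. -/
def G₁ : Subgroup (Equiv.Perm (Fin 14)) :=
  Subgroup.zpowers (finRotate 14)

end Elusive

namespace Elusive

open Finset

variable {n : ℕ}

/-! ### Every boolean function has a decision tree of depth at most `n` -/

/-! The true points of `f` form a simplicial complex with `∅` among its faces, and the proof is a
Lefschetz fixed point argument on its augmented chain complex mod 2.

A decision tree of depth less than `n` makes this complex contractible: each query splits the
current subcube in two, each leaf leaves a subcube with an unqueried direction, and the contractions
found at the leaves are glued back up the tree (`hasContraction_of_toggle`,
`HasContraction.of_split`, `hasContraction_of_tree`). By `even_card_invariant`, any symmetry of a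
contractible complex then fixes an even number of faces. But a full cycle fixes only `∅` and the
whole vertex set; the first is a face and the second is not, so the number is 1. Nothing about 14 is
used. -/

theorem exists_tree_on (f : BoolFun n) (S : Finset (Fin n)) :
    ∀ P : Finset (Fin n), ∃ T : DecisionTree n, T.ReadOnce ∧ T.vars ⊆ S ∧ T.depth ≤ #S ∧
      ∀ x, T.eval x = f (P ∪ (x ∩ S)) := by
  induction S using Finset.induction_on with
  | empty => exact fun P => ⟨.leaf (f P), trivial, by simp [DecisionTree.vars],
      by simp [DecisionTree.depth], fun x => by simp [DecisionTree.eval]⟩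
  | insert i S hi ih =>
    intro P
    -- `P` records the queried variables that were answered 1, so it changes along the tree and must
    -- be quantified inside the induction.
    obtain ⟨l, l1, l2, l3, l4⟩ := ih (insert i P)
    obtain ⟨r, r1, r2, r3, r4⟩ := ih P
    refine ⟨.node i l r, ⟨fun h => hi (l2 h), fun h => hi (r2 h), l1, r1⟩, ?_, ?_, fun x => ?_⟩
    · exact insert_subset_insert _ (union_subset l2 r2)
    · rw [card_insert_of_notMem hi]
      exact Nat.succ_le_succ (max_le l3 r3)
    · by_cases hx : i ∈ x
      · simp only [DecisionTree.eval, hx, if_true, l4, inter_insert_of_mem hx]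
        rw [insert_union, union_insert]
      · simp only [DecisionTree.eval, hx, if_false, r4, inter_insert_of_notMem hx]

theorem exists_isTreeOf_depth_le (f : BoolFun n) :
    ∃ T : DecisionTree n, T.IsTreeOf f ∧ T.depth ≤ n := by
  obtain ⟨T, h1, -, h3, h4⟩ := exists_tree_on f univ ∅
  exact ⟨T, ⟨h1, fun x => by simp [h4]⟩, by simpa using h3⟩

theorem isElusive_of_forall_le_depth {f : BoolFun n}
    (h : ∀ T : DecisionTree n, T.IsTreeOf f → n ≤ T.depth) : IsElusive f := by
  obtain ⟨T, hT, hd⟩ := exists_isTreeOf_depth_le f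
  -- Nonemptiness matters: `sInf ∅ = 0` in `ℕ`.
  have hmem : T.depth ∈ {d | ∃ T : DecisionTree n, T.IsTreeOf f ∧ T.depth = d} := ⟨T, hT, rfl⟩
  refine le_antisymm ((Nat.sInf_le hmem).trans hd) (le_csInf ⟨_, hmem⟩ ?_)
  rintro _ ⟨T', hT', rfl⟩
  exact h T' hT'

/-! ### The mod 2 boundary matrix of the full simplex and its restrictions -/

/-- Square matrices over `ZMod 2` indexed by the faces of the full simplex. -/
abbrev FaceMatrix (n : ℕ) : Type := Matrix (Finset (Fin n)) (Finset (Fin n)) (ZMod 2)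

/-- The mod 2 augmented simplicial boundary of the full simplex. -/
def boundary (n : ℕ) : FaceMatrix n :=
  Matrix.of fun B A => if B ⊆ A ∧ #A = #B + 1 then 1 else 0

/-- The projection onto the chains spanned by the faces satisfying `X`. -/
def proj (X : Finset (Fin n) → Prop) [DecidablePred X] : FaceMatrix n :=
  Matrix.diagonal fun A => if X A then 1 else 0

/-- The family `X` has a chain contraction for the restricted boundary. -/
def HasContraction (X : Finset (Fin n) → Prop) [DecidablePred X] : Prop :=
  ∃ h : FaceMatrix n, proj X * h = h ∧ h * proj X = h ∧
    proj X * boundary n * h + h * boundary n * proj X = proj X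

theorem FaceMatrix.add_self (M : FaceMatrix n) : M + M = 0 := by
  ext A B
  exact CharTwo.add_self_eq_zero _

section proj

variable (X Y : Finset (Fin n) → Prop) [DecidablePred X] [DecidablePred Y]

theorem proj_mul_apply (M : FaceMatrix n) (B A : Finset (Fin n)) :
    (proj X * M) B A = if X B then M B A else 0 := by
  simp [proj, Matrix.diagonal_mul]

theorem mul_proj_apply (M : FaceMatrix n) (B A : Finset (Fin n)) :
    (M * proj X) B A = if X A then M B A else 0 := by
  simp [proj, Matrix.mul_diagonal]

theorem proj_mul_proj : proj X * proj Y = proj fun A => X A ∧ Y A := by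
  ext B A
  rw [proj_mul_apply]
  by_cases hX : X B <;> by_cases h : B = A <;> simp_all [proj]

theorem proj_mul_self : proj X * proj X = proj X := by
  ext B A
  rw [proj_mul_apply]
  by_cases hX : X B <;> by_cases h : B = A <;> simp_all [proj]

theorem proj_eq_zero (h : ∀ A, ¬ X A) : proj X = 0 := by
  simp [proj, h]

end proj

/-- The boundary restricted to an order-convex family squares to zero. -/
theorem proj_boundary_sq (X : Finset (Fin n) → Prop) [DecidablePred X]
    (hX : ∀ A B C, X A → X C → A ⊆ B → B ⊆ C → X B) :
    proj X * boundary n * proj X * boundary n * proj X = 0 := by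
  ext B A
  rw [mul_proj_apply, mul_assoc, mul_assoc, proj_mul_apply, Matrix.zero_apply]
  split_ifs with hA hB
  swap; · rfl
  swap; · rfl
  rw [Matrix.mul_apply]
  simp only [proj_mul_apply]
  have key : ∀ C, boundary n B C * (if X C then boundary n C A else 0) ≠ 0 →
      B ⊆ C ∧ #C = #B + 1 ∧ C ⊆ A ∧ #A = #C + 1 := by
    intro C hC
    by_contra hcon
    apply hC
    simp only [boundary, Matrix.of_apply]
    split_ifs <;> simp_all
  have val : ∀ C, B ⊆ C → #C = #B + 1 → C ⊆ A → #A = #C + 1 →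
      boundary n B C * (if X C then boundary n C A else 0) = 1 := by
    intro C h1 h2 h3 h4
    have := hX B C A hB hA h1 h3
    simp only [boundary, Matrix.of_apply]
    rw [if_pos ⟨h1, h2⟩, if_pos this, if_pos ⟨h3, h4⟩, one_mul]
  have cards : ∀ C, B ⊆ C → C ⊆ A → #C = #B + 1 → #A = #C + 1 → #(B ∪ A \ C) = #B + 1 := by
    intro C h1 h2 h3 h4
    rw [card_union_of_disjoint (disjoint_sdiff.mono_left h1), card_sdiff_of_subset h2]
    omega
  -- Between `B` and `A`, two vertices apart, lie exactly two faces, exchanged by `C ↦ B ∪ A \ C`.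
  -- Convexity puts both in `X`, so their terms cancel mod 2; elsewhere the terms vanish and the
  -- involution may be the identity.
  refine Finset.sum_ninvolution (fun C => if B ⊆ C ∧ #C = #B + 1 ∧ C ⊆ A ∧ #A = #C + 1
    then B ∪ A \ C else C) ?_ ?_ ?_ ?_
  · intro C
    by_cases h : B ⊆ C ∧ #C = #B + 1 ∧ C ⊆ A ∧ #A = #C + 1
    · rw [if_pos h]
      obtain ⟨h1, h2, h3, h4⟩ := h
      have hc := cards C h1 h3 h2 h4
      rw [val C h1 h2 h3 h4, val (B ∪ A \ C) subset_union_left hc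
        (union_subset (h1.trans h3) sdiff_subset) (by omega)]
      decide
    · rw [if_neg h]
      exact CharTwo.add_self_eq_zero _
  · intro C hC
    have h := key C hC
    rw [if_pos h]
    obtain ⟨h1, h2, h3, h4⟩ := h
    intro he
    have h5 : A \ C ⊆ C := by
      intro x hx
      rw [← he]
      exact mem_union_right _ hx
    have h6 : A ⊆ C := by
      intro x hx
      by_contra hxC
      exact hxC (h5 (mem_sdiff.2 ⟨hx, hxC⟩))
    have := card_le_card h6
    omega
  · exact fun C => mem_univ _
  · intro C
    by_cases h : B ⊆ C ∧ #C = #B + 1 ∧ C ⊆ A ∧ #A = #C + 1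
    · obtain ⟨h1, h2, h3, h4⟩ := h
      have hc := cards C h1 h3 h2 h4
      simp only [h1, h2, h3, h4, and_self, if_true]
      rw [if_pos ⟨subset_union_left, hc, union_subset (h1.trans h3) sdiff_subset, by omega⟩]
      ext x
      have := @h1 x
      have := @h3 x
      simp only [mem_union, mem_sdiff]
      tauto
    · simp only [h, if_false]

/-! ### Building contractions -/

/-- A cube with a free direction is contractible. -/
theorem hasContraction_of_toggle (X : Finset (Fin n) → Prop) [DecidablePred X] (i : Fin n)
    (h1 : ∀ A, X A → X (insert i A)) (h2 : ∀ A, X A → X (A.erase i)) : HasContraction X := by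
  -- The cone operator with apex `i`: it adds `i` to faces lacking it and kills the others.
  let h : FaceMatrix n := Matrix.of fun B A => if X A ∧ i ∉ A ∧ B = insert i A then 1 else 0
  have hl : ∀ M : FaceMatrix n, ∀ B A,
      (M * h) B A = if X A ∧ i ∉ A then M B (insert i A) else 0 := by
    intro M B A
    rw [Matrix.mul_apply]
    by_cases hA : X A ∧ i ∉ A
    · simp [h, hA]
    · have : ∀ C, ¬ (X A ∧ i ∉ A ∧ C = insert i A) := fun C hC => hA ⟨hC.1, hC.2.1⟩
      simp [h, hA, this]
  have hr : ∀ M : FaceMatrix n, ∀ B A,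
      (h * M) B A = if X B ∧ i ∈ B then M (B.erase i) A else 0 := by
    intro M B A
    rw [Matrix.mul_apply]
    by_cases hB : X B ∧ i ∈ B
    · rw [if_pos hB, Finset.sum_eq_single (B.erase i)]
      · simp [h, h2 B hB.1, insert_erase hB.2]
      · intro C _ hC
        have : ¬ (X C ∧ i ∉ C ∧ B = insert i C) := by
          rintro ⟨-, h4, rfl⟩
          exact hC (erase_insert h4).symm
        simp [h, this]
      · simp
    · rw [if_neg hB]
      refine Finset.sum_eq_zero fun C _ => ?_
      have : ¬ (X C ∧ i ∉ C ∧ B = insert i C) := by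
        rintro ⟨h3, h4, rfl⟩
        exact hB ⟨h1 C h3, mem_insert_self _ _⟩
      simp [h, this]
  refine ⟨h, ?_, ?_, ?_⟩
  · ext B A
    rw [proj_mul_apply]
    split_ifs with hB
    · rfl
    · have : ¬ (X A ∧ i ∉ A ∧ B = insert i A) := by
        rintro ⟨h3, h4, rfl⟩
        exact hB (h1 A h3)
      simp [h, this]
  · ext B A
    rw [mul_proj_apply]
    split_ifs with hA
    · rfl
    · simp [h, hA]
  · ext B A
    rw [Matrix.add_apply, hl, mul_assoc, hr, mul_proj_apply, proj_mul_apply]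
    simp only [proj, Matrix.diagonal_apply, boundary, Matrix.of_apply]
    by_cases hA : X A
    swap
    · have : ¬ (B = A ∧ X B) := by rintro ⟨rfl, h⟩; exact hA h
      by_cases hBA : B = A <;> simp_all
    by_cases hB : X B
    swap
    · have : B ≠ A := by rintro rfl; exact hB hA
      simp [hB, this]
    simp only [hA, hB, true_and, if_true]
    by_cases iA : i ∈ A <;> by_cases iB : i ∈ B
    · simp only [iA, iB, not_true_eq_false, if_false, if_true, zero_add]
      refine if_congr ⟨fun ⟨h3, h4⟩ => ?_, ?_⟩ rfl rfl
      · rw [card_erase_add_one iB] at h4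
        refine eq_of_subset_of_card_le (fun x hx => ?_) h4.le
        by_cases hxi : x = i
        · exact hxi ▸ iA
        · exact h3 (mem_erase.2 ⟨hxi, hx⟩)
      · rintro rfl
        exact ⟨erase_subset _ _, (card_erase_add_one iB).symm⟩
    · have : B ≠ A := by rintro rfl; exact iB iA
      simp [iA, iB, this]
    · have : B ≠ A := by rintro rfl; exact iA iB
      simp only [iA, iB, this, not_false_eq_true, if_false, if_true]
      -- Coning and removing a vertex other than `i` commute, so the two terms are equal and cancel
      -- mod 2.
      have e : (B ⊆ insert i A ∧ #(insert i A) = #B + 1) ↔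
          (B.erase i ⊆ A ∧ #A = #(B.erase i) + 1) := by
        rw [card_erase_add_one iB, card_insert_of_notMem iA, subset_insert_iff,
          Nat.add_right_cancel_iff]
      rw [if_congr e rfl rfl]
      exact CharTwo.add_self_eq_zero _
    · simp only [iA, iB, not_false_eq_true, if_false, if_true, add_zero]
      refine if_congr ⟨fun ⟨h3, h4⟩ => ?_, ?_⟩ rfl rfl
      · rw [card_insert_of_notMem iA, Nat.add_right_cancel_iff] at h4
        refine eq_of_subset_of_card_le ?_ h4.le
        rwa [subset_insert_iff_of_notMem iB] at h3
      · rintro rfl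
        exact ⟨subset_insert _ _, card_insert_of_notMem iA⟩

/-- Contractions of two blocks of a block triangular differential glue, in characteristic two. -/
theorem exists_glued_contraction {R : Type*} [Ring R] (two : ∀ x : R, x + x = 0)
    {d p q h k : R} (pq : p * q = 0) (qp : q * p = 0) (pdq : p * d * q = 0)
    (sq : q * d * p * d * p + q * d * q * d * p = 0)
    (ph : p * h = h) (hp : h * p = h) (hh : p * d * h + h * d * p = p)
    (qk : q * k = k) (kq : k * q = k) (kk : q * d * k + k * d * q = q) :
    ∃ m : R, (p + q) * m = m ∧ m * (p + q) = m ∧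
      (p + q) * d * m + m * d * (p + q) = p + q := by
  have pk : p * k = 0 := by rw [← qk, ← mul_assoc, pq, zero_mul]
  have kp : k * p = 0 := by rw [← kq, mul_assoc, qp, mul_zero]
  have qh : q * h = 0 := by rw [← ph, ← mul_assoc, qp, zero_mul]
  have hq : h * q = 0 := by rw [← hp, mul_assoc, pq, mul_zero]
  have pdk : p * d * k = 0 := by rw [← qk, ← mul_assoc, pdq, zero_mul]
  have hdq : h * d * q = 0 := by
    rw [← hp, mul_assoc, mul_assoc, ← mul_assoc p, pdq, mul_zero]
  have two_neg : ∀ x : R, -x = x := fun x => neg_eq_of_add_eq_zero_left (two x)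
  -- This is the mapping cone formula: `d` has a block from `p` to `q` but none back, and `k * d *
  -- h` corrects for that block. Its sign is immaterial in characteristic two.
  refine ⟨h + k + k * d * h, ?_, ?_, ?_⟩
  · simp only [add_mul, mul_add, ph, pk, qh, qk, ← mul_assoc, zero_mul]
    abel
  · simp only [add_mul, mul_add, hp, hq, kp, kq, mul_assoc, mul_zero]
    abel
  · have e1 : q * d * k * d * h = q * d * h + k * d * q * d * h := by
      have : q * d * k = q + k * d * q := by
        rw [eq_sub_of_add_eq kk, sub_eq_add_neg, two_neg]
      rw [this]
      simp only [add_mul]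
    have e2 : k * d * h * d * p = k * d * p + k * d * p * d * h := by
      have : h * d * p = p + p * d * h := by
        rw [eq_sub_of_add_eq' hh, sub_eq_add_neg, two_neg]
      calc k * d * h * d * p = k * d * (h * d * p) := by simp only [mul_assoc]
        _ = _ := by rw [this]; simp only [mul_add, mul_assoc]
    have e3 : k * d * q * d * h + k * d * p * d * h = 0 := by
      have : k * (q * d * p * d * p + q * d * q * d * p) * h = 0 := by rw [sq]; simp
      rw [← this]
      simp only [mul_add, add_mul]
      have a1 : k * (q * d * p * d * p) * h = k * d * p * d * h := by
        calc _ = (k * q) * d * p * d * (p * h) := by simp only [mul_assoc]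
          _ = _ := by rw [kq, ph]
      have a2 : k * (q * d * q * d * p) * h = k * d * q * d * h := by
        calc _ = (k * q) * d * q * d * (p * h) := by simp only [mul_assoc]
          _ = _ := by rw [kq, ph]
      rw [a1, a2, add_comm]
    have e4 : p * d * k * d * h = 0 := by rw [pdk]; simp
    have e5 : k * d * h * d * q = 0 := by
      calc k * d * h * d * q = k * d * (h * d * q) := by simp only [mul_assoc]
        _ = 0 := by rw [hdq, mul_zero]
    calc (p + q) * d * (h + k + k * d * h) + (h + k + k * d * h) * d * (p + q)
        = (p * d * h + h * d * p) + (q * d * k + k * d * q) + p * d * k + h * d * q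
          + p * d * k * d * h + k * d * h * d * q + q * d * h + k * d * p
          + q * d * k * d * h + k * d * h * d * p := by
          simp only [add_mul, mul_add, ← mul_assoc]
          abel
      _ = p + q + (q * d * h + q * d * h) + (k * d * p + k * d * p)
          + (k * d * q * d * h + k * d * p * d * h) := by
          rw [hh, kk, e4, pdk, hdq, e5, e1, e2]
          abel
      _ = p + q := by rw [two, two, e3]; simp

/-- A convex family has a contraction if its members containing `i` and its members avoiding `i`
both have one. -/
theorem HasContraction.of_split (X : Finset (Fin n) → Prop) [DecidablePred X] (i : Fin n)
    (hX : ∀ A B C, X A → X C → A ⊆ B → B ⊆ C → X B)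
    (h1 : HasContraction fun A => X A ∧ i ∈ A) (h0 : HasContraction fun A => X A ∧ i ∉ A) :
    HasContraction X := by
  obtain ⟨h, ph, hp, hh⟩ := h1
  obtain ⟨k, qk, kq, kk⟩ := h0
  set p : FaceMatrix n := proj fun A => X A ∧ i ∈ A with hpdef
  set q : FaceMatrix n := proj fun A => X A ∧ i ∉ A with hqdef
  have hsum : proj X = p + q := by
    ext B A
    simp only [hpdef, hqdef, proj, Matrix.add_apply, Matrix.diagonal_apply]
    by_cases hBA : B = A <;> by_cases hXB : X B <;> by_cases hi : i ∈ B <;> simp_all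
  have pp : p * p = p := proj_mul_self _
  have qq : q * q = q := proj_mul_self _
  have pq : p * q = 0 := by
    rw [hpdef, hqdef, proj_mul_proj]
    exact proj_eq_zero _ fun A hA => hA.2.2 hA.1.2
  have qp : q * p = 0 := by
    rw [hpdef, hqdef, proj_mul_proj]
    exact proj_eq_zero _ fun A hA => hA.1.2 hA.2.2
  have pdq : p * boundary n * q = 0 := by
    ext B A
    rw [mul_proj_apply, proj_mul_apply, Matrix.zero_apply]
    split_ifs with hA hB
    · have : ¬ (B ⊆ A ∧ #A = #B + 1) := fun h => hA.2 (h.1 hB.2)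
      simp [boundary, this]
    · rfl
    · rfl
  have sq : q * boundary n * p * boundary n * p + q * boundary n * q * boundary n * p = 0 := by
    -- The block from `p` to `q` of the vanishing squared boundary.
    have := congrArg (fun M => q * M * p) (proj_boundary_sq X hX)
    simp only [hsum, mul_zero, zero_mul] at this
    rw [← this]
    calc _ = (q * q) * boundary n * p * boundary n * (p * p)
          + (q * q) * boundary n * q * boundary n * (p * p) := by rw [qq, pp]
      _ = (q * p + q * q) * boundary n * (p + q) * boundary n * (p * p + q * p) := by
          rw [qp, zero_add, add_zero]
          simp only [mul_add, add_mul]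
      _ = _ := by simp only [mul_assoc, mul_add, add_mul]
  rw [HasContraction, hsum]
  exact exists_glued_contraction FaceMatrix.add_self pq qp pdq sq ph hp hh qk kq kk

/-- If a decision tree computes the non-increasing `f` on the cube of the sets containing `P` and
avoiding `N`, and its depth is less than the dimension of the cube, then the true points of `f` in
the cube have a contraction. -/
theorem hasContraction_of_tree {f : BoolFun n} (hf : MonotoneNonincreasing f)
    (T : DecisionTree n) : ∀ P N : Finset (Fin n), T.depth + #P + #N < n →
      (∀ A, P ⊆ A → Disjoint A N → T.eval A = f A) →
      HasContraction fun A => (P ⊆ A ∧ Disjoint A N) ∧ f A = true := by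
  induction T with
  | leaf b =>
    intro P N hc he
    cases b with
    | false =>
      refine ⟨0, by simp, by simp, ?_⟩
      rw [proj_eq_zero]
      · simp
      · rintro A ⟨⟨h1, h2⟩, h3⟩
        have := he A h1 h2
        simp [DecisionTree.eval, h3] at this
    | true =>
      -- The strict depth bound enters here: some variable is still free at the leaf.
      obtain ⟨i, hi⟩ : ∃ i, i ∉ P ∪ N := by
        by_contra! hcon
        have h1 : P ∪ N = univ := eq_univ_of_forall hcon
        have h2 := card_union_le P N
        rw [h1, card_univ, Fintype.card_fin] at h2
        omega
      rw [mem_union, not_or] at hi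
      refine hasContraction_of_toggle _ i ?_ ?_
      · rintro A ⟨⟨h1, h2⟩, h3⟩
        have h4 : P ⊆ insert i A := h1.trans (subset_insert _ _)
        have h5 : Disjoint (insert i A) N := disjoint_insert_left.2 ⟨hi.2, h2⟩
        exact ⟨⟨h4, h5⟩, (he _ h4 h5).symm⟩
      · rintro A ⟨⟨h1, h2⟩, h3⟩
        exact ⟨⟨subset_erase.2 ⟨h1, hi.1⟩, h2.mono_left (erase_subset _ _)⟩,
          hf _ _ (erase_subset _ _) h3⟩
  | node i l r ihl ihr =>
    intro P N hc he
    simp only [DecisionTree.depth] at hc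
    have c1 := card_insert_le i P
    have c2 := card_insert_le i N
    have hl := ihl (insert i P) N (by omega) (by
      intro A hA hN
      rw [insert_subset_iff] at hA
      rw [← he A hA.2 hN, DecisionTree.eval, if_pos hA.1])
    have hr := ihr P (insert i N) (by omega) (by
      intro A hA hN
      rw [disjoint_insert_right] at hN
      rw [← he A hA hN.2, DecisionTree.eval, if_neg hN.1])
    refine HasContraction.of_split _ i ?_ ?_ ?_
    · rintro A B C ⟨⟨h1, -⟩, -⟩ ⟨⟨-, h2⟩, h3⟩ hAB hBC
      exact ⟨⟨h1.trans hAB, h2.mono_left hBC⟩, hf _ _ hBC h3⟩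
    · convert hl using 2 with A
      rw [insert_subset_iff]
      tauto
    · convert hr using 2 with A
      rw [disjoint_insert_right]
      tauto

/-! ### Counting invariant faces modulo 2 -/

/-- The permutation matrix of a permutation of the vertices acting on faces. -/
def faceAction (σ : Equiv.Perm (Fin n)) : FaceMatrix n :=
  Matrix.of fun B A => if B = A.map σ.toEmbedding then 1 else 0

theorem faceAction_mul_apply (σ : Equiv.Perm (Fin n)) (M : FaceMatrix n) (B A : Finset (Fin n)) :
    (faceAction σ * M) (B.map σ.toEmbedding) A = M B A := by
  rw [Matrix.mul_apply, Finset.sum_eq_single B]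
  · simp [faceAction]
  · intro C _ hC
    have : B.map σ.toEmbedding ≠ C.map σ.toEmbedding := fun h => hC (map_injective _ h).symm
    simp [faceAction, -map_inj, this]
  · simp

theorem mul_faceAction_apply (σ : Equiv.Perm (Fin n)) (M : FaceMatrix n) (B A : Finset (Fin n)) :
    (M * faceAction σ) B A = M B (A.map σ.toEmbedding) := by
  rw [Matrix.mul_apply]
  simp [faceAction]

theorem faceAction_comm (σ : Equiv.Perm (Fin n)) {M : FaceMatrix n}
    (hM : ∀ B A, M (B.map σ.toEmbedding) (A.map σ.toEmbedding) = M B A) :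
    faceAction σ * M = M * faceAction σ := by
  ext B A
  obtain ⟨C, rfl⟩ : ∃ C : Finset (Fin n), B = C.map σ.toEmbedding :=
    ⟨B.map σ.symm.toEmbedding, by ext; simp⟩
  rw [faceAction_mul_apply, mul_faceAction_apply, hM]

/-- Hopf trace argument: the trace of `S * e` counts invariant faces mod 2. Substituting the
homotopy identity for `e` gives two terms with equal traces, because `S` commutes with the boundary
and with `e` and the trace is cyclic. The contraction `h` itself need not commute with `S`. -/
theorem even_card_invariant (X : Finset (Fin n) → Prop) [DecidablePred X]
    (hX : HasContraction X) (σ : Equiv.Perm (Fin n))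
    (hσ : ∀ A, X (A.map σ.toEmbedding) ↔ X A) :
    Even #{A : Finset (Fin n) | X A ∧ A.map σ.toEmbedding = A} := by
  obtain ⟨h, ph, hp, hh⟩ := hX
  set S := faceAction σ
  set e : FaceMatrix n := proj X
  have Se : S * e = e * S := faceAction_comm σ fun B A => by
    simp only [e, proj, Matrix.diagonal_apply, map_inj, hσ]
  have Sd : S * boundary n = boundary n * S := faceAction_comm σ fun B A => by
    simp only [boundary, Matrix.of_apply, map_subset_map, card_map]
  have tr : Matrix.trace (S * e) = 0 := by
    have h1 : Matrix.trace (S * (h * boundary n * e)) = Matrix.trace (S * (e * boundary n * h)) := by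
      calc Matrix.trace (S * (h * boundary n * e))
          = Matrix.trace ((S * h) * (boundary n * e)) := by simp only [mul_assoc]
        _ = Matrix.trace ((boundary n * e) * (S * h)) := Matrix.trace_mul_comm _ _
        _ = Matrix.trace (S * boundary n * (e * h)) := by
          rw [Sd, mul_assoc, ← mul_assoc e, ← Se]; simp only [mul_assoc]
        _ = Matrix.trace (S * boundary n * (h * e)) := by rw [ph, hp]
        _ = Matrix.trace ((S * boundary n * h) * e) := by simp only [mul_assoc]
        _ = Matrix.trace (e * (S * boundary n * h)) := Matrix.trace_mul_comm _ _
        _ = Matrix.trace ((e * S) * boundary n * h) := by simp only [mul_assoc]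
        _ = _ := by rw [← Se]; simp only [mul_assoc]
    rw [← hh, mul_add, Matrix.trace_add, h1]
    exact CharTwo.add_self_eq_zero _
  rw [even_iff_two_dvd, ← ZMod.natCast_eq_zero_iff, ← tr, Matrix.trace, card_filter]
  push_cast
  refine Finset.sum_congr rfl fun A _ => ?_
  rw [Matrix.diag_apply, mul_proj_apply]
  simp only [S, faceAction, Matrix.of_apply, ite_and]
  simp only [eq_comm]

/-! ### Functions invariant under a transitive cyclic group -/

/-- A nontrivial non-increasing function that is invariant under a permutation with no invariant
sets other than `∅` and the whole set is elusive. -/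
theorem isElusive_of_invariant_sets {f : BoolFun n} (hnt : Nontrivial f)
    (hf : MonotoneNonincreasing f) (σ : Equiv.Perm (Fin n))
    (hσ : ∀ A, f (A.map σ.toEmbedding) = f A)
    (htrans : ∀ A : Finset (Fin n), A.map σ.toEmbedding = A → A = ∅ ∨ A = univ) :
    IsElusive f := by
  have hempty : f ∅ = true := by
    by_contra h
    exact hnt ⟨false, fun x => by
      by_contra hx
      exact h (hf x ∅ (empty_subset _) (by simpa using hx))⟩
  have huniv : f univ ≠ true := fun h => hnt ⟨true, fun x => hf univ x (subset_univ _) h⟩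
  refine isElusive_of_forall_le_depth fun T hT => ?_
  by_contra! hlt
  have hcon := hasContraction_of_tree hf T ∅ ∅ (by simpa using hlt) fun A _ _ => hT.2 A
  have heven := even_card_invariant _ hcon σ (by simp [hσ])
  -- Since the complex is augmented, `∅` is counted as a face and makes the count odd.
  have hone : (univ.filter fun A : Finset (Fin n) =>
      ((∅ ⊆ A ∧ Disjoint A ∅) ∧ f A = true) ∧ A.map σ.toEmbedding = A) = {∅} := by
    ext A
    simp only [mem_filter, mem_univ, true_and, mem_singleton]
    constructor
    · rintro ⟨⟨-, h1⟩, h2⟩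
      rcases htrans A h2 with h | h
      · exact h
      · exact absurd (h ▸ h1) huniv
    · rintro rfl
      simp [hempty]
  rw [hone, card_singleton] at heven
  exact absurd heven (by decide)

open Fin.NatCast in
theorem eq_empty_or_univ_of_map_finRotate {m : ℕ} (A : Finset (Fin (m + 1)))
    (hA : A.map (finRotate (m + 1)).toEmbedding = A) : A = ∅ ∨ A = univ := by
  rcases A.eq_empty_or_nonempty with h | ⟨a, ha⟩
  · exact Or.inl h
  right
  have step : ∀ x ∈ A, x + 1 ∈ A := fun x hx => by
    rw [← hA, ← finRotate_apply]
    exact mem_map_of_mem _ hx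
  have all : ∀ k : ℕ, a + (k : Fin (m + 1)) ∈ A := by
    intro k
    induction k with
    | zero => simpa using ha
    | succ k ih => simpa [add_assoc] using step _ ih
  refine eq_univ_of_forall fun x => ?_
  have := all (x - a).val
  rwa [Fin.cast_val_eq_self, add_sub_cancel] at this

end Elusive

theorem mainTheorem6 (f : Elusive.BoolFun 14)
    (hnontrivial : Elusive.Nontrivial f)
    (hmono : Elusive.MonotoneNonincreasing f)
    (hinv : Elusive.IsInvariant Elusive.G₁ f) :
    Elusive.IsElusive f :=
  Elusive.isElusive_of_invariant_sets hnontrivial hmono (finRotate 14)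
    (fun A => (hinv _ (Subgroup.mem_zpowers _) A).symm)
    Elusive.eq_empty_or_univ_of_map_finRotate
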